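/- All alphabets are finite; $A^*$ is the free monoid on $A$, and $T$ is the shift $(Tx)_n=x_{n+1}$ on $A^{\mathbb Z}$. A point $x\in A^{\mathbb Z}$ is periodic if $T^n(x)=x$ for some $n\ge 1$, and aperiodic otherwise. A morphism $\tau\colon A^*\to B^*$ acts on points by $\tau(\cdots x_{-1}\cdot x_0x_1\cdots)=\cdots\tau(x_{-1})\cdot\tau(x_0)\tau(x_1)\cdots$; this is defined only if $\tau(x_i)$ is non-empty for infinitely many $i\ge 0$ and for infinitely many $i<0$. A $\tau$-representation of $y\in B^{\mathbb Z}$ is a pair $(x,k)\in A^{\mathbb Z}\times\mathbb Z$ such that $\tau(x)$ is defined and $y=T^k(\tau(x))$; it is in $X$ if $x\in X$, and centered if $0\le k<|\tau(x_0)|$. Let $\sigma=(\sigma_n)_{n\ge 0}$ be a sequence of morphisms $\sigma_n\colon A_{n+1}^*\to A_n^*$ (possibly erasing). Let $\mathcal L^{(n)}(\sigma)\subseteq A_n^*$ be the set of all factors of the words $\sigma_n\circ\sigma_{n+1}\circ\cdots\circ\sigma_{m-1}(a)$ with $m\ge n$, $a\in A_m$ (the composition is the identity for $m=n$), and let $X^{(n)}(\sigma)$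 be the set of all points of $A_n^{\mathbb Z}$ that have all their finite factors in $\mathcal L^{(n)}(\sigma)$. The sequence $\sigma$ is recognizable at level $n$ for aperiodic points if every aperiodic point of $A_n^{\mathbb Z}$ has at most one centered $\sigma_n$-representation in $X^{(n+1)}(\sigma)$; it is representable at level $n$ if every point of $X^{(n)}(\sigma)$ has at least one $\sigma_n$-representation in $X^{(n+1)}(\sigma)$. **Proposition.** Let $m>n_1>n_2>\cdots>n_K\ge 0$, $K\ge 0$, be integers, with $A_m$ non-empty, such that, for each $1\le k\le K$, $\sigma$ is not recognizable at level $n_k$ for aperiodic points or $\sigma$ is not representable at level $n_k$. Then $K<\operatorname{Card}(A_m)$. Moreover, if $K=\operatorname{Card}(A_m)-1\ge 1$, then $X^{(n_K)}(\sigma)$ has no aperiodic points. -/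

import Mathlib

/-- The point `T^k(x)`, where `T` is the shift transformation `(T x)_n = x_{n+1}`. -/
def shiftPow {A : Type*} (k : ℤ) (x : ℤ → A) : ℤ → A := fun n => x (n + k)

/-- A point `x` is periodic if `T^n(x) = x` for some `n ≥ 1`; otherwise it is aperiodic. -/
def IsPeriodicPoint {A : Type*} (x : ℤ → A) : Prop := ∃ n : ℕ, 1 ≤ n ∧ shiftPow n x = x

/-- The word `x_i x_{i+1} ⋯ x_{i+l-1}`, the factor of length `l` of `x` that starts at `i`. -/
def pointFactor {A : Type*} (x : ℤ → A) (i : ℤ) (l : ℕ) : List A :=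
  List.ofFn fun t : Fin l => x (i + (t : ℕ))

/-- The word `σ(a)`, as a list of letters. -/
def letterImage {A B : Type*} (σ : FreeMonoid A →* FreeMonoid B) (a : A) : List B :=
  FreeMonoid.toList (σ (FreeMonoid.of a))

/-- The position in `σ(x)` at which the block `σ(x_n)` begins: `|σ(x_{[0,n)})|` for `n ≥ 0` and
`-|σ(x_{[n,0)})|` for `n < 0`. (One of the two sums is always empty.) -/
noncomputable def blockStart {A B : Type*} (σ : FreeMonoid A →* FreeMonoid B) (x : ℤ → A) (n : ℤ) : ℤ :=
  (∑ i ∈ Finset.Ico 0 n, ((letterImage σ (x i)).length : ℤ)) -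
    ∑ i ∈ Finset.Ico n 0, ((letterImage σ (x i)).length : ℤ)

/-- `σ(x)` is defined: infinitely many letters of `x` on the right, and infinitely many on the left,
are not erased by `σ`. -/
def InDomain {A B : Type*} (σ : FreeMonoid A →* FreeMonoid B) (x : ℤ → A) : Prop :=
  ∀ N : ℤ, (∃ n : ℤ, N ≤ n ∧ letterImage σ (x n) ≠ []) ∧
    ∃ n : ℤ, n ≤ N ∧ letterImage σ (x n) ≠ []

/-- `σ(x)` is defined and equal to `z`: the word `σ(x_n)` stands in `z` at positions
`blockStart σ x n, …, blockStart σ x (n + 1) - 1`, for each `n`. -/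
def IsImage {A B : Type*} (σ : FreeMonoid A →* FreeMonoid B) (x : ℤ → A) (z : ℤ → B) : Prop :=
  InDomain σ x ∧
    ∀ n : ℤ, pointFactor z (blockStart σ x n) (letterImage σ (x n)).length = letterImage σ (x n)

/-- `(x, k)` is a `σ`-representation of `y`, i.e. `y = T^k(σ(x))`. -/
def IsRepresentation {A B : Type*} (σ : FreeMonoid A →* FreeMonoid B) (y : ℤ → B)
    (x : ℤ → A) (k : ℤ) : Prop :=
  ∃ z : ℤ → B, IsImage σ x z ∧ y = shiftPow k z

/-- `(x, k)` is a centered `σ`-representation of `y`. -/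
def IsCenteredRepresentation {A B : Type*} (σ : FreeMonoid A →* FreeMonoid B) (y : ℤ → B)
    (x : ℤ → A) (k : ℤ) : Prop :=
  IsRepresentation σ y x k ∧ 0 ≤ k ∧ k < (letterImage σ (x 0)).length

/-- `σ` is recognizable in `X` for aperiodic points. -/
def RecognizableForAperiodic {A B : Type*} (σ : FreeMonoid A →* FreeMonoid B)
    (X : Set (ℤ → A)) : Prop :=
  ∀ y : ℤ → B, ¬ IsPeriodicPoint y →
    ∀ x ∈ X, ∀ x' ∈ X, ∀ k k' : ℤ,
      IsCenteredRepresentation σ y x k → IsCenteredRepresentation σ y x' k' → x = x' ∧ k = k'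

/-- `σ_{[n,n+j)} = σ_n ∘ σ_{n+1} ∘ ⋯ ∘ σ_{n+j-1}`, for a sequence of morphisms
`σ_n : A_{n+1}^* → A_n^*`. -/
def sadicComp {A : ℕ → Type*} (σ : ∀ n, FreeMonoid (A (n + 1)) →* FreeMonoid (A n)) (n : ℕ) :
    ∀ j : ℕ, FreeMonoid (A (n + j)) →* FreeMonoid (A n)
  | 0 => MonoidHom.id _
  | j + 1 => (sadicComp σ n j).comp (σ (n + j))

/-- The language `L^{(n)}(σ)`: all factors of the words `σ_{[n,m)}(a)`, `m ≥ n`, `a ∈ A_m`. -/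
def sadicLanguage {A : ℕ → Type*} (σ : ∀ n, FreeMonoid (A (n + 1)) →* FreeMonoid (A n)) (n : ℕ) :
    Set (List (A n)) :=
  {w | ∃ (j : ℕ) (a : A (n + j)), w <:+: letterImage (sadicComp σ n j) a}

/-- The shift space `X^{(n)}(σ)`: all points that have all their factors in `L^{(n)}(σ)`. -/
def sadicShift {A : ℕ → Type*} (σ : ∀ n, FreeMonoid (A (n + 1)) →* FreeMonoid (A n)) (n : ℕ) :
    Set (ℤ → A n) :=
  {x | ∀ (i : ℤ) (l : ℕ), pointFactor x i l ∈ sadicLanguage σ n}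

/-- `σ` is recognizable at level `n` for aperiodic points. -/
def RecognizableForAperiodicAt {A : ℕ → Type*}
    (σ : ∀ n, FreeMonoid (A (n + 1)) →* FreeMonoid (A n)) (n : ℕ) : Prop :=
  RecognizableForAperiodic (σ n) (sadicShift σ (n + 1))

/-- `σ` is representable at level `n`: every point of `X^{(n)}(σ)` has a `σ_n`-representation in
`X^{(n+1)}(σ)`. -/
def RepresentableAt {A : ℕ → Type*}
    (σ : ∀ n, FreeMonoid (A (n + 1)) →* FreeMonoid (A n)) (n : ℕ) : Prop :=
  ∀ y ∈ sadicShift σ n, ∃ x ∈ sadicShift σ (n + 1), ∃ k : ℤ, IsRepresentation (σ n) y x k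

/-! Call a morphism on `k` letters elementary if it does not factor through `k - 1` letters. Going
down from level `m`, one keeps a morphism `f` on `k` letters and a set of words `L` whose images
have as factors, up to bounded length, exactly the language of the level (`Generates`). At level `m`
the letters of `A m` serve; descending one level composes `f` with `σ n` and keeps `k`. If this
composite is elementary, then `σ n` is recognizable for aperiodic points and representable there. So
each bad level makes the composite factor through `k - 1` letters, and this cannot go down to no
letters, where both properties hold vacuously. With a single letter left, every point is a
bi-infinite power of one word, hence periodic.

Representability comes from compactness: a point generated by a non-erasing morphism has a parse
into images of letters. Recognizability reduces to `IsParse.eq_of_aperiodic`. By the defect theorem,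
two parses with a common cut agree to its right. A refined defect theorem
(`HasRelation.factorsThrough_two`) shows that a cut of one parse inside a block of the other
determines the next letter. Away from common cuts the pair of parses therefore evolves to the right
deterministically through finitely many states. Some state recurs infinitely often towards the left,
so parses that differ force the point to be periodic. -/

/-! ### Morphisms factoring through fewer letters -/

/-- The morphism given on letters by `f` factors through a free monoid on `k` letters. -/
def FactorsThrough {D B : Type*} (f : D → List B) (k : ℕ) : Prop :=
  ∃ (β : D → List (Fin k)) (α : Fin k → List B), ∀ d, f d = (β d).flatMap α

theorem FactorsThrough.of_fintype {D C B : Type*} [Fintype C] {f : D → List B} {k : ℕ}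
    (β : D → List C) (α : C → List B) (h : ∀ d, f d = (β d).flatMap α)
    (hk : Fintype.card C ≤ k) : FactorsThrough f k := by
  obtain ⟨e⟩ : Nonempty (C ↪ Fin k) :=
    Function.Embedding.nonempty_of_card_le (by simpa using hk)
  refine ⟨fun d => (β d).map e, Function.extend e α fun _ => [], fun d => ?_⟩
  rw [h d, List.flatMap_map]
  exact congrArg (fun g => List.flatMap g (β d))
    (funext fun c => (e.injective.extend_apply α _ c).symm)

theorem FactorsThrough.comp {D E B : Type*} {f : E → List B} {k : ℕ} (h : FactorsThrough f k)
    (τ : D → List E) : FactorsThrough (fun d => (τ d).flatMap f) k := by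
  obtain ⟨β, α, hf⟩ := h
  refine ⟨fun d => (τ d).flatMap β, α, fun d => ?_⟩
  rw [List.flatMap_assoc]
  exact congrArg (fun g => List.flatMap g (τ d)) (funext hf)

theorem FactorsThrough.congr {D B : Type*} {f g : D → List B} {k : ℕ} (h : FactorsThrough f k)
    (hfg : ∀ d, f d = g d) : FactorsThrough g k := by
  rwa [← funext hfg]

/-- A morphism that identifies a letter `b` with a word over the other letters factors through
the other letters. -/
theorem FactorsThrough.of_eliminate {D B : Type*} [Fintype D] [DecidableEq D] {f : D → List B}
    (b : D) (w : List {d // d ≠ b}) (hb : f b = w.flatMap fun d => f d) {k : ℕ}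
    (h : FactorsThrough (fun d : {d // d ≠ b} => f d) k) : FactorsThrough f k := by
  refine (h.comp fun d => if hd : d = b then w else [⟨d, hd⟩]).congr fun d => ?_
  by_cases hd : d = b
  · subst hd; simp [hb]
  · simp [hd]

theorem FactorsThrough.restrict_self {D B : Type*} [Fintype D] [DecidableEq D] (f : D → List B)
    (b : D) : FactorsThrough (fun d : {d // d ≠ b} => f d) (Fintype.card D - 1) :=
  .of_fintype (fun d => [d]) (fun d => f d) (fun d => by simp)
    (by rw [Fintype.card_subtype_compl, Fintype.card_subtype_eq])

/-! ### Relations between words and defect theorems -/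

/-- Two words that begin with the distinct letters `a` and `b` have long, prefix-comparable
images. -/
def HasRelation {D B : Type*} [Fintype D] (f : D → List B) (a b : D) : Prop :=
  a ≠ b ∧ ∃ (U V : List D) (z : List B),
    (a :: U).flatMap f <+: z ∧ (b :: V).flatMap f <+: z ∧
      ∑ d, (f d).length ≤ ((a :: U).flatMap f).length ∧
      ∑ d, (f d).length ≤ ((b :: V).flatMap f).length

theorem HasRelation.symm {D B : Type*} [Fintype D] {f : D → List B} {a b : D}
    (h : HasRelation f a b) : HasRelation f b a := by
  obtain ⟨h, U, V, z, h1, h2, h3, h4⟩ := h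
  exact ⟨h.symm, V, U, z, h2, h1, h4, h3⟩

theorem HasRelation.prefix_or_prefix {D B : Type*} [Fintype D] {f : D → List B} {a b : D}
    (h : HasRelation f a b) : f a <+: f b ∨ f b <+: f a := by
  obtain ⟨-, U, V, z, h1, h2, -, -⟩ := h
  rw [List.flatMap_cons] at h1 h2
  exact List.prefix_or_prefix_of_prefix ((List.prefix_append _ _).trans h1)
    ((List.prefix_append _ _).trans h2)

section Elimination

variable {D B : Type*} [DecidableEq D]

/-- The elementary transformation `b ↦ ab`. -/
def prependLetter (a b : D) (d : D) : List D := if d = b then [a, b] else [d]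

theorem flatMap_prependLetter_head_ne {a b : D} (hab : a ≠ b) (U : List D) (d : D) (W : List D)
    (h : U.flatMap (prependLetter a b) = d :: W) : d ≠ b := by
  cases U with
  | nil => simp at h
  | cons c U =>
    rw [List.flatMap_cons, prependLetter] at h
    split_ifs at h with hc
    · simp only [List.cons_append, List.cons.injEq] at h; exact h.1 ▸ hab
    · simp only [List.cons_append, List.cons.injEq] at h; exact h.1 ▸ hc

theorem flatMap_flatMap_prependLetter {f : D → List B} {a b : D} {s : List B} (hab : a ≠ b)
    (hs : f b = f a ++ s) (U : List D) :
    (U.flatMap (prependLetter a b)).flatMap (Function.update f b s) = U.flatMap f := by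
  rw [List.flatMap_assoc]
  congr 1
  funext d
  by_cases hd : d = b
  · subst hd; simp [prependLetter, hs, hab]
  · simp [prependLetter, hd]

theorem update_ne_nil {f : D → List B} (hf : ∀ d, f d ≠ []) {b : D} {s : List B} (hs : s ≠ [])
    (d : D) : Function.update f b s d ≠ [] := by
  by_cases hd : d = b
  · subst hd; simpa using hs
  · simpa [hd] using hf d

theorem FactorsThrough.of_update {f : D → List B} {a b : D} {s : List B} (hab : a ≠ b)
    (hs : f b = f a ++ s) {k : ℕ} (h : FactorsThrough (Function.update f b s) k) :
    FactorsThrough f k :=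
  (h.comp (prependLetter a b)).congr fun d => by
    simpa [List.flatMap_cons] using flatMap_flatMap_prependLetter hab hs [d]

variable [Fintype D]

theorem sum_length_update {f : D → List B} {a b : D} {s : List B} (hs : f b = f a ++ s) :
    ∑ d, (f d).length = (f a).length + ∑ d, (Function.update f b s d).length := by
  rw [← Finset.add_sum_erase _ (fun d => (f d).length) (Finset.mem_univ b),
    ← Finset.add_sum_erase _ (fun d => (Function.update f b s d).length)
      (Finset.mem_univ b), hs]
  have : ∑ d ∈ Finset.univ.erase b, (Function.update f b s d).length =
      ∑ d ∈ Finset.univ.erase b, (f d).length :=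
    Finset.sum_congr rfl fun d hd => by simp [Finset.ne_of_mem_erase hd]
  simp [this, add_assoc]

/-- Cancelling `f a` on both sides leaves a relation for the shortened morphism. The words and the
total length of the morphism both lose `(f a).length`, so the length bound of `HasRelation` is
preserved and the elimination can be iterated. -/
theorem HasRelation.eliminate_self {f : D → List B} {a b : D} {s : List B}
    (h : HasRelation f a b) (hs : f b = f a ++ s) (hs0 : s ≠ []) :
    ∃ d, HasRelation (Function.update f b s) b d := by
  obtain ⟨hab, U, V, z, h1, h2, h3, h4⟩ := h
  have hsum := sum_length_update hs
  rw [List.flatMap_cons] at h1 h2 h3 h4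
  obtain ⟨z, rfl⟩ := (List.prefix_append _ _).trans h1
  rw [hs, List.append_assoc, List.prefix_append_right_inj] at h2
  rw [List.prefix_append_right_inj] at h1
  rw [List.length_append] at h3 h4
  have hb : Function.update f b s b = s := by simp
  have hpos : 0 < ∑ d, (Function.update f b s d).length :=
    (List.length_pos_of_ne_nil (by simpa using hs0)).trans_le
      (Finset.single_le_sum (f := fun d => (Function.update f b s d).length)
        (fun _ _ => Nat.zero_le _) (Finset.mem_univ b))
  have hU := flatMap_flatMap_prependLetter hab hs U
  have hV := flatMap_flatMap_prependLetter hab hs V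
  rcases hW : U.flatMap (prependLetter a b) with - | ⟨d, W⟩
  -- An empty remainder would have length 0, against the bound by the total length, which is
  -- positive since `s` is non-empty.
  · rw [hW] at hU
    simp only [List.flatMap_nil] at hU
    rw [← hU] at h3
    simp at h3
    omega
  · rw [hW] at hU
    refine ⟨d, (flatMap_prependLetter_head_ne hab U d W hW).symm,
      V.flatMap (prependLetter a b), W, z, ?_, ?_, ?_, ?_⟩
    · rwa [List.flatMap_cons, hV, hb]
    · rwa [hU]
    · rw [List.flatMap_cons, hV, hb]
      rw [hs] at h4
      simp only [List.length_append] at h4 ⊢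
      omega
    · rw [hU]; omega

/-- Rewriting by `b ↦ ab` changes no image and only turns an initial `b` into `a`; the initial
letters stay distinct unless they are `a` and `b`. -/
theorem HasRelation.eliminate_other {f : D → List B} {a b c d : D} {s : List B} (hab : a ≠ b)
    (h : HasRelation f c d) (hs : f b = f a ++ s)
    (h1 : ¬ (c = a ∧ d = b)) (h2 : ¬ (c = b ∧ d = a)) :
    HasRelation (Function.update f b s) (if c = b then a else c) (if d = b then a else d) := by
  obtain ⟨hcd, U, V, z, h3, h4, h5, h6⟩ := h
  have hsum := sum_length_update hs
  have key : ∀ (c : D) (U : List D), ∃ U', (c :: U).flatMap (prependLetter a b) =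
      (if c = b then a else c) :: U' := by
    intro c U
    by_cases hc : c = b <;> simp [prependLetter, hc]
  obtain ⟨U', hU'⟩ := key c U
  obtain ⟨V', hV'⟩ := key d V
  refine ⟨?_, U', V', z, ?_⟩
  · split_ifs <;> aesop
  · rw [← hU', ← hV', flatMap_flatMap_prependLetter hab hs, flatMap_flatMap_prependLetter hab hs]
    exact ⟨h3, h4, by omega, by omega⟩

theorem HasRelation.restrict {f : D → List B} {a b c d : D} (hab : a ≠ b) (heq : f b = f a)
    (h : HasRelation f c d) (h1 : ¬ (c = a ∧ d = b)) (h2 : ¬ (c = b ∧ d = a)) :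
    ∃ c' d', HasRelation (fun d : {d // d ≠ b} => f d) c' d' := by
  obtain ⟨hcd, U, V, z, h3, h4, h5, h6⟩ := h
  let r : D → {d // d ≠ b} := fun d => if hd : d = b then ⟨a, hab⟩ else ⟨d, hd⟩
  have hr : ∀ U : List D, (U.map r).flatMap (fun d : {d // d ≠ b} => f d) = U.flatMap f := by
    intro U
    rw [List.flatMap_map]
    congr 1
    funext d
    by_cases hd : d = b <;> simp [r, hd, heq]
  have hsum : ∑ d : {d // d ≠ b}, (f d).length ≤ ∑ d, (f d).length := by
    rw [Fintype.sum_eq_add_sum_subtype_ne _ b]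
    omega
  refine ⟨r c, r d, ?_, U.map r, V.map r, z, ?_⟩
  · intro hrcd
    simp only [r] at hrcd
    split_ifs at hrcd <;> aesop
  · rw [← List.map_cons, ← List.map_cons, hr, hr]
    exact ⟨h3, h4, hsum.trans h5, hsum.trans h6⟩

/-- One-sided defect theorem. -/
theorem HasRelation.factorsThrough {f : D → List B} (hf : ∀ d, f d ≠ []) {a b : D}
    (h : HasRelation f a b) : FactorsThrough f (Fintype.card D - 1) := by
  induction hN : ∑ d, (f d).length using Nat.strong_induction_on generalizing f a b with
  | _ N ih =>
    subst hN
    wlog hp : f a <+: f b generalizing a b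
    · exact this h.symm (h.prefix_or_prefix.resolve_left hp)
    obtain ⟨s, hs⟩ := hp
    by_cases hs0 : s = []
    · subst hs0
      exact .of_eliminate b [⟨a, h.1⟩] (by simp [← hs]) (.restrict_self f b)
    · obtain ⟨d, hd⟩ := h.eliminate_self hs.symm hs0
      refine .of_update h.1 hs.symm (ih _ ?_ (update_ne_nil hf hs0) hd rfl)
      have := List.length_pos_of_ne_nil (hf a)
      rw [sum_length_update hs.symm]
      omega

/-- Two independent relations lower the number of letters by two. -/
theorem HasRelation.factorsThrough_two {f : D → List B} (hf : ∀ d, f d ≠ []) {a b c d : D}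
    (h : HasRelation f a b) (h' : HasRelation f c d)
    (h1 : ¬ (c = a ∧ d = b)) (h2 : ¬ (c = b ∧ d = a)) :
    FactorsThrough f (Fintype.card D - 2) := by
  induction hN : ∑ d, (f d).length using Nat.strong_induction_on generalizing f a b c d with
  | _ N ih =>
    subst hN
    wlog hp : f a <+: f b generalizing a b
    · exact this h.symm h2 h1 (h.prefix_or_prefix.resolve_left hp)
    obtain ⟨s, hs⟩ := hp
    by_cases hs0 : s = []
    · subst hs0
      obtain ⟨c', d', hr⟩ := h'.restrict h.1 (by simpa using hs.symm) h1 h2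
      refine .of_eliminate b [⟨a, h.1⟩] (by simp [← hs]) ?_
      have := HasRelation.factorsThrough (f := fun d : {d // d ≠ b} => f d) (fun d => hf d) hr
      rwa [Fintype.card_subtype_compl, Fintype.card_subtype_eq] at this
    · obtain ⟨e, he⟩ := h.eliminate_self hs.symm hs0
      have hr := h'.eliminate_other h.1 hs.symm h1 h2
      -- The first new relation involves `b` and the second does not, so they are again independent.
      have hne : ∀ c : D, b ≠ if c = b then a else c := by
        intro c
        split_ifs with hc
        · exact h.1.symm
        · exact fun h => hc h.symm
      refine .of_update h.1 hs.symm (ih _ ?_ (update_ne_nil hf hs0) he hr ?_ ?_ rfl)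
      · have := List.length_pos_of_ne_nil (hf a)
        rw [sum_length_update hs.symm]
        omega
      · exact fun h => hne c h.1.symm
      · exact fun h => hne d h.2.symm

end Elimination

/-! ### Occurrences of words in points -/

/-- The word `w` stands in `y` at position `i`. -/
def OccursAt {B : Type*} (y : ℤ → B) (i : ℤ) (w : List B) : Prop := pointFactor y i w.length = w

section Occurrences

variable {A B : Type*} {y : ℤ → B}

@[simp] theorem length_pointFactor (y : ℤ → B) (i : ℤ) (l : ℕ) : (pointFactor y i l).length = l := by
  simp [pointFactor]

@[simp] theorem getElem_pointFactor (y : ℤ → B) (i : ℤ) (l k : ℕ)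
    (h : k < (pointFactor y i l).length) : (pointFactor y i l)[k] = y (i + k) := by
  simp [pointFactor]

@[simp] theorem pointFactor_zero (y : ℤ → B) (i : ℤ) : pointFactor y i 0 = [] := by
  simp [pointFactor]

theorem pointFactor_succ (y : ℤ → B) (i : ℤ) (l : ℕ) :
    pointFactor y i (l + 1) = y i :: pointFactor y (i + 1) l := by
  simp [pointFactor, List.ofFn_succ, add_assoc, add_comm (1 : ℤ)]

theorem pointFactor_add (y : ℤ → B) (i : ℤ) (k l : ℕ) :
    pointFactor y i (k + l) = pointFactor y i k ++ pointFactor y (i + k) l := by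
  induction k generalizing i with
  | zero => simp
  | succ k ih =>
    rw [Nat.add_right_comm, pointFactor_succ, pointFactor_succ, ih, List.cons_append]
    push_cast
    rw [add_assoc, add_comm (1 : ℤ)]

theorem pointFactor_prefix (y : ℤ → B) (i : ℤ) {k l : ℕ} (h : k ≤ l) :
    pointFactor y i k <+: pointFactor y i l := by
  obtain ⟨d, rfl⟩ := Nat.exists_eq_add_of_le h
  rw [pointFactor_add]
  exact List.prefix_append _ _

theorem pointFactor_infix (y : ℤ → B) {i j : ℤ} {k l : ℕ} (h : i ≤ j) (h' : j + k ≤ i + l) :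
    pointFactor y j k <:+: pointFactor y i l := by
  obtain ⟨d, rfl⟩ := Int.le.dest h
  obtain ⟨e, rfl⟩ : ∃ e, l = d + (k + e) := ⟨l - (d + k), by omega⟩
  rw [pointFactor_add, pointFactor_add]
  exact ⟨_, _, List.append_assoc _ _ _⟩

theorem occursAt_append {i : ℤ} {u v : List B} :
    OccursAt y i (u ++ v) ↔ OccursAt y i u ∧ OccursAt y (i + u.length) v := by
  rw [OccursAt, List.length_append, pointFactor_add]
  exact ⟨fun h => List.append_inj h (by simp), fun h => by rw [h.1, h.2]⟩

theorem OccursAt.getElem {i : ℤ} {w : List B} (h : OccursAt y i w) {k : ℕ} (hk : k < w.length) :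
    y (i + k) = w[k] := by
  rw [← getElem_pointFactor y i w.length k (by simpa using hk)]
  exact List.getElem_of_eq h _

theorem HasRelation.of_occursAt [Fintype A] {f : A → List B} {i : ℤ} {a b : A} (hab : a ≠ b)
    {U V : List A} (hU : OccursAt y i ((a :: U).flatMap f)) (hV : OccursAt y i ((b :: V).flatMap f))
    (hU' : ∑ d, (f d).length ≤ ((a :: U).flatMap f).length)
    (hV' : ∑ d, (f d).length ≤ ((b :: V).flatMap f).length) : HasRelation f a b := by
  refine ⟨hab, U, V, pointFactor y i
    (max ((a :: U).flatMap f).length ((b :: V).flatMap f).length), ?_, ?_, hU', hV'⟩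
  · have := pointFactor_prefix y i
      (le_max_left ((a :: U).flatMap f).length ((b :: V).flatMap f).length)
    rwa [hU] at this
  · have := pointFactor_prefix y i
      (le_max_right ((a :: U).flatMap f).length ((b :: V).flatMap f).length)
    rwa [hV] at this

theorem length_le_length_flatMap {f : A → List B} (hf : ∀ a, f a ≠ []) (U : List A) :
    U.length ≤ (U.flatMap f).length := by
  induction U with
  | nil => simp
  | cons a U ih =>
    have := List.length_pos_of_ne_nil (hf a)
    simp only [List.flatMap_cons, List.length_cons, List.length_append]
    omega

end Occurrences

/-! ### Parses and recognizability of elementary morphisms -/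

/-- The words `f (x n)` stand in `y` one after the other, the `n`-th at position `c n`, and cover
all of `y`. -/
structure IsParse {A B : Type*} (f : A → List B) (y : ℤ → B) (x : ℤ → A) (c : ℤ → ℤ) : Prop where
  step : ∀ n, c (n + 1) = c n + (f (x n)).length
  occursAt : ∀ n, OccursAt y (c n) (f (x n))
  above : ∀ M, ∃ n, M ≤ c n
  below : ∀ M, ∃ n, c n ≤ M

namespace IsParse

variable {A B : Type*} {f : A → List B} {y : ℤ → B} {x x' : ℤ → A} {c c' : ℤ → ℤ}

theorem monotone (h : IsParse f y x c) : Monotone c :=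
  monotone_int_of_le_succ fun n => by rw [h.step n]; omega

theorem strictMono (h : IsParse f y x c) (hf : ∀ a, f a ≠ []) : StrictMono c :=
  strictMono_int_of_lt_succ fun n => by
    have := List.length_pos_of_ne_nil (hf (x n))
    rw [h.step n]; omega

theorem exists_index (h : IsParse f y x c) (m : ℤ) : ∃ n, c n ≤ m ∧ m < c (n + 1) := by
  obtain ⟨N, hN⟩ := h.above (m + 1)
  obtain ⟨n, hn, hmax⟩ := Int.exists_greatest_of_bdd (P := fun n => c n ≤ m)
    ⟨N, fun z hz => by
      by_contra hlt
      have := h.monotone (not_le.1 hlt).le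
      omega⟩ (h.below m)
  refine ⟨n, hn, ?_⟩
  by_contra hlt
  have := hmax (n + 1) (not_lt.1 hlt)
  omega

theorem index_unique (h : IsParse f y x c) {m n n' : ℤ} (hn : c n ≤ m) (hn1 : m < c (n + 1))
    (hn' : c n' ≤ m) (hn1' : m < c (n' + 1)) : n = n' := by
  rcases lt_trichotomy n n' with hlt | heq | hlt
  · have := h.monotone (show n + 1 ≤ n' by omega); omega
  · exact heq
  · have := h.monotone (show n' + 1 ≤ n by omega); omega

theorem occursAt_flatMap (h : IsParse f y x c) (n : ℤ) (l : ℕ) :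
    OccursAt y (c n) ((pointFactor x n l).flatMap f) ∧
      c (n + l) = c n + ((pointFactor x n l).flatMap f).length := by
  induction l generalizing n with
  | zero => simp [OccursAt]
  | succ l ih =>
    rw [pointFactor_succ, List.flatMap_cons, occursAt_append, ← h.step n, List.length_append]
    refine ⟨⟨h.occursAt n, (ih _).1⟩, ?_⟩
    have := (ih (n + 1)).2
    rw [h.step n] at this
    push_cast
    rw [← add_assoc (c n), ← this, ← add_assoc, add_right_comm]

/-- A factor of length at least `S` has a long image. -/
theorem le_length_flatMap (hf : ∀ a, f a ≠ []) (x : ℤ → A) (n : ℤ) (S : ℕ) :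
    S ≤ ((pointFactor x n S).flatMap f).length :=
  (length_pointFactor x n S).symm.le.trans (length_le_length_flatMap hf _)

/-- The positions `p` and `q` lie in blocks of the same letter, at the same offset. -/
def SameOffset (x : ℤ → A) (c I : ℤ → ℤ) (p q : ℤ) : Prop :=
  x (I p) = x (I q) ∧ p - c (I p) = q - c (I q)

theorem apply_eq_of_sameOffset (h : IsParse f y x c) {I : ℤ → ℤ}
    (hI : ∀ m, c (I m) ≤ m ∧ m < c (I m + 1)) {p q : ℤ} (hs : SameOffset x c I p q) :
    y p = y q := by
  obtain ⟨e1, e2⟩ := hs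
  have hIp := hI p
  have hp := h.step (I p)
  have ho := h.occursAt (I p)
  have ho' := h.occursAt (I q)
  rw [← e1] at ho'
  obtain ⟨k, hk⟩ : ∃ k : ℕ, p = c (I p) + k := ⟨(p - c (I p)).toNat, by omega⟩
  have hk' : q = c (I q) + k := by omega
  have hlt : k < (f (x (I p))).length := by omega
  rw [hk, hk', ho.getElem hlt, ho'.getElem hlt]

variable [Fintype A]

/-- Distinct letters after a common cut would give a relation, with words as long as needed since
both parses continue forever; the defect theorem excludes it. -/
theorem eq_of_common_cut (hf : ∀ a, f a ≠ [])
    (hel : ¬ FactorsThrough f (Fintype.card A - 1)) (h : IsParse f y x c) (h' : IsParse f y x' c')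
    {n n' : ℤ} (hcut : c n = c' n') : x n = x' n' := by
  classical
  by_contra hne
  refine hel (HasRelation.factorsThrough hf
    (.of_occursAt (i := c n) (y := y) hne (U := pointFactor x (n + 1) (∑ d, (f d).length))
      (V := pointFactor x' (n' + 1) (∑ d, (f d).length)) ?_ ?_ ?_ ?_))
  · rw [← pointFactor_succ]
    exact (h.occursAt_flatMap n _).1
  · rw [← pointFactor_succ, hcut]
    exact (h'.occursAt_flatMap n' _).1
  · rw [List.flatMap_cons, List.length_append]
    exact (le_length_flatMap hf x _ _).trans (Nat.le_add_left _ _)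
  · rw [List.flatMap_cons, List.length_append]
    exact (le_length_flatMap hf x' _ _).trans (Nat.le_add_left _ _)

theorem eq_add_of_common_cut (hf : ∀ a, f a ≠ [])
    (hel : ¬ FactorsThrough f (Fintype.card A - 1)) (h : IsParse f y x c) (h' : IsParse f y x' c')
    {n n' : ℤ} (hcut : c n = c' n') (k : ℕ) :
    x (n + k) = x' (n' + k) ∧ c (n + k) = c' (n' + k) := by
  induction k with
  | zero => simpa using ⟨eq_of_common_cut hf hel h h' hcut, hcut⟩
  | succ k ih =>
    have hc : c (n + (k + 1 : ℕ)) = c' (n' + (k + 1 : ℕ)) := by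
      push_cast
      rw [← add_assoc, ← add_assoc, h.step, h'.step, ih.1, ih.2]
    exact ⟨eq_of_common_cut hf hel h h' hc, hc⟩

/-- A cut of one parse inside a letter of the other one determines the letter that follows. -/
theorem eq_of_inner_cut (hf : ∀ a, f a ≠ [])
    (hel : ¬ FactorsThrough f (Fintype.card A - 1)) (h : IsParse f y x c) (h' : IsParse f y x' c')
    {n n₂ j k : ℤ} (hx : x' j = x' k) (hj : c' j < c n) (hj1 : c n < c' (j + 1))
    (hoff : c n - c' j = c n₂ - c' k) : x n = x n₂ := by
  classical
  by_contra hne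
  obtain ⟨a, ha⟩ : ∃ a, a = x' j := ⟨_, rfl⟩
  obtain ⟨p, hp⟩ : ∃ p : ℕ, c n = c' j + p := ⟨(c n - c' j).toNat, by omega⟩
  have hp0 : 0 < p := by omega
  have hpa : p < (f a).length := by
    rw [h'.step j] at hj1
    rw [ha]; omega
  -- Split `a` at the cut into two letters: `some a` carries the first `p` letters of `f a`, `none`
  -- the rest. This costs one extra letter.
  let φ : Option A → List B := fun o => o.elim ((f a).drop p)
    fun d => if d = a then (f a).take p else f d
  let τ : A → List (Option A) := fun d => if d = a then [some a, none] else [some d]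
  have hτφ : ∀ d, (τ d).flatMap φ = f d := by
    intro d
    by_cases hd : d = a
    · subst hd; simp [τ, φ]
    · simp [τ, φ, hd]
  have hτφ' : ∀ U : List A, (U.flatMap τ).flatMap φ = U.flatMap f := by
    intro U
    rw [List.flatMap_assoc, funext hτφ]
  have hφ : ∀ o, φ o ≠ [] := by
    rintro (_ | d)
    · simpa [φ] using hpa
    · by_cases hd : d = a
      · simpa [φ, hd, hp0.ne'] using hf a
      · simpa [φ, hd] using hf d
  have hhead : ∀ (d : A) (U : List A), ∃ V, (d :: U).flatMap τ = some d :: V := by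
    intro d U
    by_cases hd : d = a
    · exact ⟨none :: U.flatMap τ, by simp [τ, hd]⟩
    · exact ⟨U.flatMap τ, by simp [τ, hd]⟩
  have hrel : ∀ n j, x' j = a → c n = c' j + p → HasRelation φ none (some (x n)) := by
    intro n j hja hcn
    set S := ∑ d, (φ d).length
    obtain ⟨V, hV⟩ := hhead (x n) (pointFactor x (n + 1) S)
    have hV' : (some (x n) :: V).flatMap φ = (pointFactor x n (S + 1)).flatMap f := by
      rw [← hV, hτφ', ← pointFactor_succ]
    have hU : ((none : Option A) :: (pointFactor x' (j + 1) S).flatMap τ).flatMap φ =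
        (f a).drop p ++ (pointFactor x' (j + 1) S).flatMap f := by
      rw [List.flatMap_cons, hτφ']; rfl
    refine .of_occursAt (y := y) (i := c n) (by simp)
      (U := (pointFactor x' (j + 1) S).flatMap τ) (V := V) ?_ ?_ ?_ ?_
    · have := (h'.occursAt_flatMap j (S + 1)).1
      rw [pointFactor_succ, List.flatMap_cons, hja, ← List.take_append_drop p (f a),
        List.append_assoc, occursAt_append, List.length_take, min_eq_left hpa.le, ← hcn] at this
      rw [hU]; exact this.2
    · rw [hV']; exact (h.occursAt_flatMap n _).1
    · rw [hU, List.length_append]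
      exact (le_length_flatMap hf x' _ _).trans (Nat.le_add_left _ _)
    · rw [hV']; exact (Nat.le_succ S).trans (le_length_flatMap hf x _ _)
  -- Two independent relations on `card A + 1` letters leave `card A - 1`.
  have := HasRelation.factorsThrough_two hφ (hrel n j ha.symm hp)
    (hrel n₂ k (by rw [ha, hx]) (by omega)) (by simpa using fun h => hne h.symm) (by simp)
  rw [Fintype.card_option] at this
  exact hel ((this.comp τ).congr hτφ)

/-- If a block of `x` ends here while the block of `x'` goes on, the new cut is interior to the
latter and `eq_of_inner_cut` gives the next letter; otherwise only the offset grows. -/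
theorem SameOffset.succ (hf : ∀ a, f a ≠ [])
    (hel : ¬ FactorsThrough f (Fintype.card A - 1)) (h : IsParse f y x c) (h' : IsParse f y x' c')
    {I I' : ℤ → ℤ} (hI : ∀ m, c (I m) ≤ m ∧ m < c (I m + 1))
    (hI' : ∀ m, c' (I' m) ≤ m ∧ m < c' (I' m + 1)) {p q : ℤ}
    (hs : SameOffset x c I p q) (hs' : SameOffset x' c' I' p q)
    (hcut : ¬ (p + 1 = c (I p + 1) ∧ p + 1 = c' (I' p + 1))) :
    SameOffset x c I (p + 1) (q + 1) := by
  have hp := h.step (I p)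
  have hq := h.step (I q)
  have hIp := hI p
  have hIq := hI q
  have hIp' := hI' p
  obtain ⟨e1, e2⟩ := hs
  rw [← e1] at hq
  by_cases hend : p + 1 = c (I p + 1)
  · have hendq : q + 1 = c (I q + 1) := by omega
    have hnp : I (p + 1) = I p + 1 :=
      h.index_unique (hI (p + 1)).1 (hI (p + 1)).2 hend.ge (hend ▸ h.strictMono hf (lt_add_one _))
    have hnq : I (q + 1) = I q + 1 :=
      h.index_unique (hI (q + 1)).1 (hI (q + 1)).2 hendq.ge
        (hendq ▸ h.strictMono hf (lt_add_one _))
    refine ⟨?_, by rw [hnp, hnq]; omega⟩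
    rw [hnp, hnq]
    have hne : p + 1 ≠ c' (I' p + 1) := fun he => hcut ⟨hend, he⟩
    obtain ⟨e1', e2'⟩ := hs'
    exact eq_of_inner_cut hf hel h h' e1' (by omega) (by omega) (by omega)
  · have hnp : I (p + 1) = I p :=
      h.index_unique (hI (p + 1)).1 (hI (p + 1)).2 (by omega) (by omega)
    have hnq : I (q + 1) = I q :=
      h.index_unique (hI (q + 1)).1 (hI (q + 1)).2 (by omega) (by omega)
    exact ⟨by rw [hnp, hnq, e1], by rw [hnp, hnq]; omega⟩

/-- Pigeonhole: letters and offsets in both parses take finitely many values, so one state recurs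
arbitrarily far to the left. -/
theorem exists_frequently_sameOffset (h : IsParse f y x c) (h' : IsParse f y x' c')
    {I I' : ℤ → ℤ} (hI : ∀ m, c (I m) ≤ m ∧ m < c (I m + 1))
    (hI' : ∀ m, c' (I' m) ≤ m ∧ m < c' (I' m + 1)) :
    ∃ S : Set ℤ, (∀ M, ∃ m ∈ S, m < M) ∧
      ∀ p ∈ S, ∀ q ∈ S, SameOffset x c I p q ∧ SameOffset x' c' I' p q := by
  obtain ⟨R, hR⟩ : ∃ R : ℕ, ∀ a, (f a).length ≤ R :=
    ⟨∑ a, (f a).length, fun a =>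
      Finset.single_le_sum (f := fun a => (f a).length) (fun _ _ => Nat.zero_le _)
        (Finset.mem_univ a)⟩
  let st : ℤ → (A × ℤ) × (A × ℤ) := fun m =>
    ((x (I m), m - c (I m)), (x' (I' m), m - c' (I' m)))
  let T : Set ((A × ℤ) × (A × ℤ)) := (Set.univ ×ˢ Set.Ico 0 (R : ℤ)) ×ˢ (Set.univ ×ˢ Set.Ico 0 (R : ℤ))
  have hT : T.Finite := (Set.finite_univ.prod (Set.finite_Ico _ _)).prod
    (Set.finite_univ.prod (Set.finite_Ico _ _))
  have hst : ∀ m, st m ∈ T := by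
    intro m
    have h1 := hI m
    have h2 := hI' m
    rw [h.step] at h1
    rw [h'.step] at h2
    have h3 := hR (x (I m))
    have h4 := hR (x' (I' m))
    simp only [T, st, Set.mem_prod, Set.mem_univ, Set.mem_Ico, true_and]
    omega
  obtain ⟨v, -, hv⟩ : ∃ v ∈ T, ∃ᶠ m in Filter.atBot, st m = v := by
    by_contra hno
    push Not at hno
    have := (hT.eventually_all (l := Filter.atBot) (p := fun v m => st m ≠ v)).2 hno
    obtain ⟨m, hm⟩ := this.exists
    exact hm _ (hst m) rfl
  refine ⟨{m | st m = v}, fun M => ?_, fun p hp q hq => ?_⟩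
  · obtain ⟨m, hm, hlt⟩ := (hv.and_eventually (Filter.eventually_lt_atBot M)).exists
    exact ⟨m, hm, hlt⟩
  · have : st p = st q := Eq.trans hp (Eq.symm hq)
    simp only [st, Prod.mk.injEq] at this
    exact this

/-- Two parses of an aperiodic point with respect to an elementary morphism coincide. -/
theorem eq_of_aperiodic (hf : ∀ a, f a ≠ [])
    (hel : ¬ FactorsThrough f (Fintype.card A - 1)) (h : IsParse f y x c) (h' : IsParse f y x' c')
    (hy : ¬ IsPeriodicPoint y) : ∃ t, ∀ n, x n = x' (n + t) ∧ c n = c' (n + t) := by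
  -- If common cuts go arbitrarily far left, agreement to the right of each one gives agreement
  -- everywhere.
  by_cases hcut : ∀ M, ∃ n n', c n = c' n' ∧ c n ≤ M
  · obtain ⟨n₀, n₀', h₀, -⟩ := hcut 0
    refine ⟨n₀' - n₀, fun n => ?_⟩
    obtain ⟨n₁, n₁', h₁, hle⟩ := hcut (c (min n n₀))
    have hle := (h.strictMono hf).le_iff_le.1 hle
    obtain ⟨k, hk⟩ := Int.le.dest (hle.trans (min_le_left _ _))
    obtain ⟨l, hl⟩ := Int.le.dest (hle.trans (min_le_right _ _))
    have h2 := (eq_add_of_common_cut hf hel h h' h₁ l).2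
    rw [hl, h₀] at h2
    have h3 := (h'.strictMono hf).injective h2
    have h4 := eq_add_of_common_cut hf hel h h' h₁ k
    rw [hk] at h4
    rwa [show n + (n₀' - n₀) = n₁' + k by omega]
  · exfalso
    push Not at hcut
    obtain ⟨M, hM⟩ := hcut
    choose I hI using h.exists_index
    choose I' hI' using h'.exists_index
    obtain ⟨S, hS, hSS⟩ := exists_frequently_sameOffset h h' hI hI'
    have hstep : ∀ p q, SameOffset x c I p q ∧ SameOffset x' c' I' p q →
        ¬ (p + 1 = c (I p + 1) ∧ p + 1 = c' (I' p + 1)) →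
        SameOffset x c I (p + 1) (q + 1) ∧ SameOffset x' c' I' (p + 1) (q + 1) :=
      fun p q hs hne => ⟨.succ hf hel h h' hI hI' hs.1 hs.2 hne,
        .succ hf hel h' h hI' hI hs.2 hs.1 fun he => hne he.symm⟩
    -- Otherwise there is a least common cut `m₀`. Two occurrences `p < q < m₀` of the recurrent
    -- state evolve alike until `q + k` reaches `m₀ - 1`, so `p + k + 1 < m₀` is a common cut too.
    have hnone : ∀ n n', c n ≠ c' n' := by
      intro n n' hnn
      obtain ⟨m₀, ⟨n₀, n₀', h₀, h₀'⟩, hmin⟩ := Int.exists_least_of_bdd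
        (P := fun m => ∃ n n', c n = m ∧ c' n' = m)
        ⟨M, fun z ⟨n, n', hz, hz'⟩ => hz ▸ (hM n n' (hz.trans hz'.symm)).le⟩ ⟨_, n, n', rfl, hnn.symm⟩
      obtain ⟨q, hq, hqm⟩ := hS m₀
      obtain ⟨p, hp, hpq⟩ := hS q
      have hno : ∀ r, r + 1 < m₀ → ¬ (r + 1 = c (I r + 1) ∧ r + 1 = c' (I' r + 1)) :=
        fun r hr he => absurd (hmin (r + 1) ⟨_, _, he.1.symm, he.2.symm⟩) (not_le.2 hr)
      have hsync : ∀ k : ℕ, q + k < m₀ → SameOffset x c I (p + k) (q + k) ∧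
          SameOffset x' c' I' (p + k) (q + k) := by
        intro k
        induction k with
        | zero => intro _; simpa using hSS p hp q hq
        | succ k ih =>
          intro hk
          push_cast at hk ⊢
          rw [← add_assoc, ← add_assoc]
          exact hstep _ _ (ih (by omega)) (hno _ (by omega))
      obtain ⟨k, hk⟩ : ∃ k : ℕ, q + k + 1 = m₀ := ⟨(m₀ - q - 1).toNat, by omega⟩
      obtain ⟨⟨e1, e2⟩, e1', e2'⟩ := hsync k (by omega)
      refine hno (p + k) (by omega) ?_
      have hend : ∀ {x : ℤ → A} {c I : ℤ → ℤ} {n : ℤ}, IsParse f y x c →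
          (∀ m, c (I m) ≤ m ∧ m < c (I m + 1)) → c n = m₀ → c (I (q + k) + 1) = m₀ := by
        intro x c I n h hI hn
        have h1 := hI (q + k)
        have : I (q + k) < n := (h.strictMono hf).lt_iff_lt.1 (by omega)
        have := h.monotone (show I (q + k) + 1 ≤ n by omega)
        omega
      have h1 := hend h hI h₀
      have h2 := hend h' hI' h₀'
      rw [h.step] at h1 ⊢
      rw [h'.step] at h2 ⊢
      rw [e1, e1']
      omega
    -- Without common cuts the evolution never desynchronizes. As `S` is unbounded below, `q - p` is
    -- then a period of all of `y`.
    have hsync : ∀ p ∈ S, ∀ q ∈ S, ∀ k : ℕ, y (p + k) = y (q + k) := by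
      intro p hp q hq k
      refine h.apply_eq_of_sameOffset hI (And.left (b := SameOffset x' c' I' (p + k) (q + k)) ?_)
      induction k with
      | zero => simpa using hSS p hp q hq
      | succ k ih =>
        push_cast
        rw [← add_assoc, ← add_assoc]
        exact hstep _ _ ih fun he => hnone _ _ (he.1.symm.trans he.2)
    obtain ⟨q, hq, -⟩ := hS 0
    obtain ⟨p, hp, hpq⟩ := hS q
    refine hy ⟨(q - p).toNat, by omega, funext fun n => ?_⟩
    obtain ⟨r, hr, hrn⟩ := hS n
    obtain ⟨k, rfl⟩ := Int.le.dest hrn.le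
    have h1 := hsync r hr p hp k
    have h2 := hsync q hq r hr k
    have h3 := hsync r hr p hp (k + (q - p).toNat)
    rw [shiftPow, h1.trans ((hsync p hp r hr k).trans (h2.symm)), add_assoc, ← Nat.cast_add, h3]
    congr 1
    push_cast
    omega

end IsParse

/-! ### Sequences of cuts with prescribed block lengths -/

section Cuts

theorem eq_of_forall_succ_eq {X : Type*} {g : ℤ → X} (hg : ∀ n, g (n + 1) = g n) (n m : ℤ) :
    g n = g m := by
  have key : ∀ n (k : ℕ), g (n + k) = g n := by
    intro n k
    induction k with
    | zero => simp
    | succ k ih => push_cast; rw [← add_assoc, hg, ih]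
  rcases le_total n m with h | h
  · obtain ⟨k, rfl⟩ := Int.le.dest h; exact (key n k).symm
  · obtain ⟨k, rfl⟩ := Int.le.dest h; exact key m k

theorem sum_Ico_sub_sum_Ico_succ (g : ℤ → ℤ) (n : ℤ) :
    (∑ i ∈ Finset.Ico 0 (n + 1), g i) - ∑ i ∈ Finset.Ico (n + 1) 0, g i =
      ((∑ i ∈ Finset.Ico 0 n, g i) - ∑ i ∈ Finset.Ico n 0, g i) + g n := by
  rcases le_or_gt 0 n with h | h
  · have e : Finset.Ico 0 (n + 1) = insert n (Finset.Ico 0 n) := by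
      ext i; simp only [Finset.mem_Ico, Finset.mem_insert]; omega
    rw [e, Finset.sum_insert (by simp), Finset.Ico_eq_empty_of_le (show (0 : ℤ) ≤ n + 1 by omega),
      Finset.Ico_eq_empty_of_le h]
    simp [add_comm]
  · have e : Finset.Ico n 0 = insert n (Finset.Ico (n + 1) 0) := by
      ext i; simp only [Finset.mem_Ico, Finset.mem_insert]; omega
    rw [e, Finset.sum_insert (by simp), Finset.Ico_eq_empty_of_le (show n + 1 ≤ (0 : ℤ) by omega),
      Finset.Ico_eq_empty_of_le h.le]
    simp

theorem exists_cuts (g : ℤ → ℤ) (j k : ℤ) :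
    ∃ c : ℤ → ℤ, c j = k ∧ ∀ n, c (n + 1) = c n + g n := by
  refine ⟨fun n => ((∑ i ∈ Finset.Ico 0 n, g i) - ∑ i ∈ Finset.Ico n 0, g i) +
    (k - ((∑ i ∈ Finset.Ico 0 j, g i) - ∑ i ∈ Finset.Ico j 0, g i)), by ring, fun n => ?_⟩
  dsimp only
  rw [sum_Ico_sub_sum_Ico_succ]
  ring

theorem add_le_of_step {g c : ℤ → ℤ} (hg : ∀ n, 1 ≤ g n) (hc : ∀ n, c (n + 1) = c n + g n) :
    Monotone fun n => c n - n :=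
  monotone_int_of_le_succ fun n => by have := hg n; simp only [hc]; omega

theorem exists_le_of_step {g c : ℤ → ℤ} (hg : ∀ n, 1 ≤ g n) (hc : ∀ n, c (n + 1) = c n + g n)
    (M : ℤ) : (∃ n, M ≤ c n) ∧ ∃ n, c n ≤ M := by
  have h1 := add_le_of_step hg hc (le_max_left 0 (M - c 0))
  have h2 := add_le_of_step hg hc (min_le_left 0 (M - c 0))
  have h3 := le_max_right 0 (M - c 0)
  have h4 := min_le_right 0 (M - c 0)
  dsimp only at h1 h2
  exact ⟨⟨_, show M ≤ c (max 0 (M - c 0)) by omega⟩, ⟨_, show c (min 0 (M - c 0)) ≤ M by omega⟩⟩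

end Cuts

/-! ### Images of points and composition of parses -/

section Images

variable {A B C : Type*}

/-- The image of a bi-infinite point. -/
theorem exists_isParse {f : A → List B} {x : ℤ → A} {c : ℤ → ℤ}
    (hstep : ∀ n, c (n + 1) = c n + (f (x n)).length) (habove : ∀ M, ∃ n, M ≤ c n)
    (hbelow : ∀ M, ∃ n, c n ≤ M) : ∃ z, IsParse f z x c := by
  -- A parse over a one-letter alphabet makes the index lemmas available before `z` exists.
  have hu : IsParse (fun a => List.replicate (f a).length ()) (fun _ => ()) x c :=
    ⟨fun n => by simpa using hstep n, fun n => List.ext_getElem (by simp) fun _ _ _ => rfl,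
      habove, hbelow⟩
  have key : ∀ m, ∃ b, ∀ n (k : ℕ) (hk : k < (f (x n)).length), c n + k = m →
      (f (x n))[k] = b := by
    intro m
    obtain ⟨n₀, h1, h2⟩ := hu.exists_index m
    have h3 := hstep n₀
    refine ⟨(f (x n₀))[(m - c n₀).toNat]'(by omega), fun n k hk hm => ?_⟩
    have h4 := hstep n
    obtain rfl : n₀ = n := hu.index_unique h1 h2 (by omega) (by omega)
    congr 1
    omega
  choose z hz using key
  refine ⟨z, hstep, fun n => List.ext_getElem (by simp) fun k hk hk' => ?_, habove, hbelow⟩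
  rw [getElem_pointFactor]
  exact (hz _ n k hk' rfl).symm

theorem exists_isParse_of_ne_nil {f : A → List B} (hf : ∀ a, f a ≠ []) (x : ℤ → A) (j k : ℤ) :
    ∃ z c, IsParse f z x c ∧ c j = k := by
  obtain ⟨c, hc, hstep⟩ := exists_cuts (fun n => ((f (x n)).length : ℤ)) j k
  have h := exists_le_of_step (fun n => by
    have := List.length_pos_of_ne_nil (hf (x n)); omega) hstep
  obtain ⟨z, hz⟩ := exists_isParse hstep (fun M => (h M).1) (fun M => (h M).2)
  exact ⟨z, c, hz, hc⟩

theorem IsParse.comp {f : C → List B} {g : B → List A} {y : ℤ → A} {z : ℤ → B} {u : ℤ → C}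
    {b c : ℤ → ℤ} (hg : IsParse g y z b) (hf : IsParse f z u c) :
    IsParse (fun a => (f a).flatMap g) y u (fun n => b (c n)) := by
  have key := fun n => hg.occursAt_flatMap (c n) (f (u n)).length
  simp only [show ∀ n, pointFactor z (c n) (f (u n)).length = f (u n)
    from hf.occursAt] at key
  refine ⟨fun n => by rw [hf.step, (key n).2], fun n => (key n).1, fun M => ?_, fun M => ?_⟩
  · obtain ⟨i, hi⟩ := hg.above M
    obtain ⟨n, hn⟩ := hf.above i
    exact ⟨n, hi.trans (hg.monotone hn)⟩
  · obtain ⟨i, hi⟩ := hg.below M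
    obtain ⟨n, hn⟩ := hf.below i
    exact ⟨n, (hg.monotone hn).trans hi⟩

theorem IsParse.of_comp {f : C → List B} {g : B → List A} {y : ℤ → A} {z : ℤ → B} {u : ℤ → C}
    {e c : ℤ → ℤ} (hh : IsParse (fun a => (f a).flatMap g) y u e) (hf : IsParse f z u c) :
    ∃ b, IsParse g y z b := by
  obtain ⟨b, hb0, hb⟩ := exists_cuts (fun n => ((g (z n)).length : ℤ)) (c 0) (e 0)
  have hadd : ∀ m (l : ℕ), b (m + l) = b m + ((pointFactor z m l).flatMap g).length := by
    intro m l
    induction l generalizing m with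
    | zero => simp
    | succ l ih =>
      have := ih (m + 1)
      rw [hb] at this
      rw [pointFactor_succ, List.flatMap_cons, List.length_append]
      push_cast
      rw [← add_assoc (b m), ← this, ← add_assoc, add_right_comm]
  have hfac : ∀ n, pointFactor z (c n) (f (u n)).length = f (u n) := hf.occursAt
  -- The finer cuts `b` refine the given cuts `e`: both grow by the same block lengths and agree at
  -- 0.
  have hbe : ∀ n, b (c n) = e n := by
    intro n
    have := eq_of_forall_succ_eq (g := fun n => b (c n) - e n) (fun n => by
      rw [hf.step, hadd, hfac, hh.step]
      ring) n 0
    simp only [hb0] at this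
    omega
  refine ⟨b, hb, fun m => ?_, fun M => ?_, fun M => ?_⟩
  · obtain ⟨n, h1, h2⟩ := hf.exists_index m
    rw [hf.step] at h2
    obtain ⟨k, rfl⟩ := Int.le.dest h1
    obtain ⟨r, hr⟩ : ∃ r, (f (u n)).length = k + (r + 1) :=
      ⟨(f (u n)).length - k - 1, by omega⟩
    have ho := hh.occursAt n
    rw [← hfac n, hr, pointFactor_add, pointFactor_succ, List.flatMap_append, List.flatMap_cons,
      occursAt_append, occursAt_append, ← hbe, ← hadd] at ho
    exact ho.2.1
  · obtain ⟨n, hn⟩ := hh.above M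
    exact ⟨c n, hn.trans (hbe n).ge⟩
  · obtain ⟨n, hn⟩ := hh.below M
    exact ⟨c n, (hbe n).le.trans hn⟩

theorem IsParse.shift {f : A → List B} {y : ℤ → B} {x : ℤ → A} {c : ℤ → ℤ} (h : IsParse f y x c)
    (j : ℤ) : IsParse f y (fun n => x (n + j)) (fun n => c (n + j)) := by
  refine ⟨fun n => ?_, fun n => h.occursAt _, fun M => ?_, fun M => ?_⟩
  · rw [add_right_comm, h.step]
  · obtain ⟨n, hn⟩ := h.above M
    exact ⟨n - j, by simpa using hn⟩
  · obtain ⟨n, hn⟩ := h.below M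
    exact ⟨n - j, by simpa using hn⟩

end Images

/-! ### Desubstitution by compactness -/

/-- The points all of whose factors are factors of images of words of `L`. -/
def wordShift {C B : Type*} (f : C → List B) (L : Set (List C)) : Set (ℤ → B) :=
  {y | ∀ i l, ∃ w ∈ L, pointFactor y i l <:+: w.flatMap f}

section Desubstitution

variable {A B C : Type*}

theorem pointFactor_congr {y z : ℤ → B} {i : ℤ} {l : ℕ}
    (h : ∀ m, i ≤ m → m < i + l → y m = z m) : pointFactor y i l = pointFactor z i l := by
  refine List.ext_getElem (by simp) fun k hk _ => ?_
  rw [length_pointFactor] at hk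
  rw [getElem_pointFactor, getElem_pointFactor]
  exact h _ (by omega) (by omega)

theorem eq_of_pointFactor_eq {y z : ℤ → B} {i : ℤ} {l : ℕ}
    (h : pointFactor y i l = pointFactor z i l) {m : ℤ} (h1 : i ≤ m) (h2 : m < i + l) :
    y m = z m := by
  obtain ⟨k, rfl⟩ := Int.le.dest h1
  have hk : k < l := by omega
  rw [← getElem_pointFactor y i l k (by simpa), ← getElem_pointFactor z i l k (by simpa)]
  exact List.getElem_of_eq h _

theorem exists_partial_parse {f : C → List B} (hf : ∀ a, f a ≠ []) {L : Set (List C)} {y : ℤ → B}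
    (hy : y ∈ wordShift f L) (N : ℕ) :
    ∃ (x : ℤ → C) (c : ℤ → ℤ), (∀ n, c (n + 1) = c n + (f (x n)).length) ∧ c 0 ≤ 0 ∧ 0 < c 1 ∧
      (∀ n, -(N : ℤ) ≤ c n → c (n + 1) ≤ N → OccursAt y (c n) (f (x n))) ∧
      ∀ i (l : ℕ), -(N : ℤ) ≤ c i → c (i + l) ≤ N → ∃ w ∈ L, pointFactor x i l <:+: w := by
  obtain ⟨w, hw, p, q, hpq⟩ := hy (-(N : ℤ)) (2 * N + 1)
  obtain ⟨a₀⟩ : Nonempty C := by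
    cases w with
    | nil => simpa using congrArg List.length hpq
    | cons a _ => exact ⟨a⟩
  let x : ℤ → C := fun n => w.getD n.toNat a₀
  have hx : pointFactor x 0 w.length = w :=
    List.ext_getElem (by simp) fun k hk hk' => by simp [x, hk']
  -- The image of `w` is placed so that the factor between `p` and `q` covers the positions from
  -- `-N` to `N`, as in `y`.
  obtain ⟨z, c, hz, hc0⟩ := exists_isParse_of_ne_nil hf x 0 (-(N : ℤ) - p.length)
  have hmono := hz.strictMono hf
  have hall := hz.occursAt_flatMap 0 w.length
  rw [hx, ← hpq, hc0, occursAt_append, occursAt_append] at hall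
  obtain ⟨⟨⟨-, hmid⟩, -⟩, hend⟩ := hall
  rw [sub_add_cancel, OccursAt, length_pointFactor] at hmid
  simp only [List.length_append, length_pointFactor, zero_add] at hend
  push_cast at hend
  obtain ⟨j, hj, hj1⟩ := hz.exists_index 0
  refine ⟨fun n => x (n + j), fun n => c (n + j), (hz.shift j).step, by simpa using hj,
    by simpa [add_comm] using hj1, fun n h1 h2 => ?_, fun i l h1 h2 => ⟨w, hw, ?_⟩⟩
  · dsimp only at h1 h2 ⊢
    have ho := (hz.shift j).occursAt n
    have hs := (hz.shift j).step n
    rw [OccursAt] at ho ⊢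
    rw [← ho, length_pointFactor]
    exact pointFactor_congr fun m hm hm' =>
      (eq_of_pointFactor_eq hmid (by omega) (by push_cast; omega)).symm
  · dsimp only at h1 h2
    have h3 : 0 ≤ i + j := hmono.le_iff_le.1 (by omega)
    have h4 : i + l + j ≤ w.length := hmono.le_iff_le.1 (by omega)
    have := pointFactor_infix x (i := 0) (j := i + j) (k := l) (l := w.length) h3 (by omega)
    rw [hx] at this
    convert this using 1
    exact List.ext_getElem (by simp) fun k _ _ => by simp [add_right_comm]

theorem Ultrafilter.exists_eventually_eq {ι X : Type*} (U : Ultrafilter ι) (s : ι → X)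
    {T : Set X} (hT : T.Finite) (hs : ∀ i, s i ∈ T) : ∃ a, ∀ᶠ i in (U : Filter ι), s i = a := by
  by_contra hno
  push Not at hno
  have : ∀ a ∈ T, ∀ᶠ i in (U : Filter ι), s i ≠ a := fun a _ => hno a
  obtain ⟨i, hi⟩ := ((hT.eventually_all (p := fun a i => s i ≠ a)).2 this).exists
  exact hi _ (hs i) rfl

/-- Points generated by the images of `L` under a non-erasing morphism are images of points
generated by `L`. -/
theorem exists_isParse_of_mem_wordShift [Finite C] {f : C → List B} (hf : ∀ a, f a ≠ [])
    {L : Set (List C)} {y : ℤ → B} (hy : y ∈ wordShift f L) :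
    ∃ (x : ℤ → C) (c : ℤ → ℤ), IsParse f y x c ∧
      ∀ i l, ∃ w ∈ L, pointFactor x i l <:+: w := by
  choose x c hstep hc0 hc1 hocc hlang using exists_partial_parse hf hy
  have := Fintype.ofFinite C
  let R := ∑ a, (f a).length
  have hR : ∀ a, (f a).length ≤ R := fun a =>
    Finset.single_le_sum (f := fun a => (f a).length) (fun _ _ => Nat.zero_le _)
      (Finset.mem_univ a)
  let U : Ultrafilter ℕ := Filter.hyperfilter ℕ
  have hU : (U : Filter ℕ) ≤ Filter.atTop := Nat.hyperfilter_le_atTop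
  choose X hX using fun n => U.exists_eventually_eq (fun N => x N n) Set.finite_univ
    (fun _ => Set.mem_univ _)
  -- The block at index 0 covers position 0 and has length at most `R`, so its start takes finitely
  -- many values; all other limit cuts follow from it and the limit letters.
  obtain ⟨k, hk⟩ := U.exists_eventually_eq (fun N => c N 0) (Set.finite_Icc (-(R : ℤ)) 0)
    (fun N => ⟨by
      have h1 := hstep N 0
      have h2 := hc1 N
      have h3 := hR (x N 0)
      rw [zero_add] at h1
      omega, hc0 N⟩)
  obtain ⟨c', hc', hstep'⟩ := exists_cuts (fun n => ((f (X n)).length : ℤ)) 0 k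
  have hev : ∀ n, ∀ᶠ N in (U : Filter ℕ), c N n = c' n := by
    have hiff : ∀ n, (∀ᶠ N in (U : Filter ℕ), c N (n + 1) = c' (n + 1)) =
        ∀ᶠ N in (U : Filter ℕ), c N n = c' n := by
      intro n
      refine propext (Filter.eventually_congr ?_)
      filter_upwards [hX n] with N hN
      rw [hstep, hstep', hN]
      omega
    intro n
    rw [eq_of_forall_succ_eq (g := fun n => ∀ᶠ N in (U : Filter ℕ), c N n = c' n) hiff n 0, hc']
    exact hk
  have hbig : ∀ M : ℤ, ∀ᶠ N : ℕ in (U : Filter ℕ), M ≤ N := fun M =>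
    hU (tendsto_natCast_atTop_atTop.eventually (Filter.eventually_ge_atTop M))
  have hunb := exists_le_of_step (fun n => by
    have := List.length_pos_of_ne_nil (hf (X n)); omega) hstep'
  refine ⟨X, c', ⟨hstep', fun n => ?_, fun M => (hunb M).1, fun M => (hunb M).2⟩, fun i l => ?_⟩
  · obtain ⟨N, h1, h2, h3, h4, h5⟩ := ((hX n).and ((hev n).and ((hev (n + 1)).and
      ((hbig (-c' n)).and (hbig (c' (n + 1))))))).exists
    have := hocc N n (by omega) (by omega)
    rwa [h1, h2] at this
  · have hall : ∀ᶠ N in (U : Filter ℕ), ∀ m ∈ Set.Ico i (i + l), x N m = X m :=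
      (Set.finite_Ico _ _).eventually_all.2 fun m _ => hX m
    obtain ⟨N, h1, h2, h3, h4, h5⟩ := (hall.and ((hev i).and ((hev (i + l)).and
      ((hbig (-c' i)).and (hbig (c' (i + l))))))).exists
    obtain ⟨w, hw, hi⟩ := hlang N i l (by omega) (by omega)
    refine ⟨w, hw, ?_⟩
    rwa [← pointFactor_congr fun m hm hm' => h1 m ⟨hm, hm'⟩]

theorem flatMap_ne_nil_of_not_factorsThrough [Fintype C] {f : C → List B}
    (hel : ¬ FactorsThrough f (Fintype.card C - 1)) (a : C) : f a ≠ [] := by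
  classical
  exact fun ha => hel (.of_eliminate a [] (by simpa using ha) (.restrict_self f a))

variable [Fintype C] {f : C → List B} {g : B → List A} {L : Set (List C)}

/-- If the composition is elementary, then `g` is recognizable for aperiodic points. -/
theorem eq_of_isParse_of_not_factorsThrough
    (hel : ¬ FactorsThrough (fun a => (f a).flatMap g) (Fintype.card C - 1))
    {y : ℤ → A} (hy : ¬ IsPeriodicPoint y) {x x' : ℤ → B} (hx : x ∈ wordShift f L)
    (hx' : x' ∈ wordShift f L) {b b' : ℤ → ℤ} (h : IsParse g y x b) (h' : IsParse g y x' b')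
    (h0 : b 0 ≤ 0 ∧ 0 < b 1) (h0' : b' 0 ≤ 0 ∧ 0 < b' 1) : x = x' ∧ b 0 = b' 0 := by
  have hh := flatMap_ne_nil_of_not_factorsThrough hel
  have hf : ∀ a, f a ≠ [] := fun a ha => hh a (by simp [ha])
  obtain ⟨u, c, hu, -⟩ := exists_isParse_of_mem_wordShift hf hx
  obtain ⟨u', c', hu', -⟩ := exists_isParse_of_mem_wordShift hf hx'
  obtain ⟨t, ht⟩ := (h.comp hu).eq_of_aperiodic hh hel (h'.comp hu') hy
  have hr : ∀ n, c' (n + t) - c n = c' (0 + t) - c 0 := fun n =>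
    eq_of_forall_succ_eq (g := fun n => c' (n + t) - c n) (fun n => by
      rw [add_right_comm, hu'.step, hu.step, (ht n).1]
      ring) n 0
  -- The parses of `y` by the composite agree up to the index shift `t`, so `x` and `x'` agree up to
  -- the shift `r`.
  obtain ⟨r, hr0⟩ : ∃ r, r = c' (0 + t) - c 0 := ⟨_, rfl⟩
  rw [← hr0] at hr
  have hxx : ∀ m, x m = x' (m + r) := by
    intro m
    obtain ⟨n, h1, h2⟩ := hu.exists_index m
    rw [hu.step] at h2
    obtain ⟨k, rfl⟩ := Int.le.dest h1
    have hk : k < (f (u n)).length := by omega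
    have hk' : k < (f (u' (n + t))).length := by rwa [← (ht n).1]
    rw [(hu.occursAt n).getElem hk, show c n + k + r = c' (n + t) + k by have := hr n; omega,
      (hu'.occursAt (n + t)).getElem hk']
    exact List.getElem_of_eq (congrArg f (ht n).1) _
  have hbb : ∀ m, b m = b' (m + r) := by
    intro m
    have := eq_of_forall_succ_eq (g := fun m => b m - b' (m + r)) (fun m => by
      rw [add_right_comm, h.step, h'.step, hxx]
      ring) m (c 0)
    have h2 := (ht 0).2
    rw [hr0] at this ⊢
    simp only [show c 0 + (c' (0 + t) - c 0) = c' (0 + t) by ring] at this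
    omega
  -- Centering: the blocks of index `r` and 0 in the second parse both contain position 0.
  obtain rfl : r = 0 := h'.index_unique (m := 0) (by rw [← zero_add r, ← hbb]; exact h0.1)
    (by rw [add_comm r, ← hbb]; exact h0.2) h0'.1 (by simpa using h0'.2)
  exact ⟨funext fun m => by simpa using hxx m, by simpa using hbb 0⟩

/-- If the composition is elementary, then the points that it generates are images under `g` of
points generated by `f`. -/
theorem exists_isParse_of_not_factorsThrough
    (hel : ¬ FactorsThrough (fun a => (f a).flatMap g) (Fintype.card C - 1))
    {y : ℤ → A} (hy : y ∈ wordShift (fun a => (f a).flatMap g) L) :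
    ∃ x ∈ wordShift f L, ∃ b, IsParse g y x b := by
  have hh := flatMap_ne_nil_of_not_factorsThrough hel
  have hf : ∀ a, f a ≠ [] := fun a ha => hh a (by simp [ha])
  obtain ⟨u, e, hu, hL⟩ := exists_isParse_of_mem_wordShift hh hy
  obtain ⟨z, c, hz, -⟩ := exists_isParse_of_ne_nil hf u 0 0
  refine ⟨z, fun i l => ?_, hu.of_comp hz⟩
  obtain ⟨n, hn, -⟩ := hz.exists_index i
  obtain ⟨n', -, hn'⟩ := hz.exists_index (i + l)
  have hlt : n < n' + 1 := (hz.strictMono hf).lt_iff_lt.1 (by omega)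
  obtain ⟨k, hk⟩ := Int.le.dest hlt.le
  obtain ⟨w, hw, s, t, rfl⟩ := hL n k
  refine ⟨_, hw, ?_⟩
  have ho := hz.occursAt_flatMap n k
  rw [hk] at ho
  rw [List.flatMap_append, List.flatMap_append]
  refine List.IsInfix.trans ?_ ⟨_, _, rfl⟩
  rw [← ho.1]
  exact pointFactor_infix z hn (by omega)

end Desubstitution

/-! ### Representations as parses -/

section Representations

variable {A B : Type*} {σ : FreeMonoid A →* FreeMonoid B} {y : ℤ → B} {x : ℤ → A}

theorem blockStart_succ (σ : FreeMonoid A →* FreeMonoid B) (x : ℤ → A) (n : ℤ) :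
    blockStart σ x (n + 1) = blockStart σ x n + (letterImage σ (x n)).length :=
  sum_Ico_sub_sum_Ico_succ (fun i => ((letterImage σ (x i)).length : ℤ)) n

theorem pointFactor_shiftPow (k : ℤ) (z : ℤ → B) (i : ℤ) (l : ℕ) :
    pointFactor (shiftPow k z) i l = pointFactor z (i + k) l :=
  List.ext_getElem (by simp) fun j _ _ => by simp [shiftPow, add_right_comm]

theorem InDomain.exists_le {c : ℤ → ℤ} (h : InDomain σ x)
    (hstep : ∀ n, c (n + 1) = c n + (letterImage σ (x n)).length) (M : ℤ) :
    (∃ n, M ≤ c n) ∧ ∃ n, c n ≤ M := by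
  have hmono : Monotone c := monotone_int_of_le_succ fun n => by rw [hstep n]; omega
  have hup : ∀ t : ℕ, ∃ n, c 0 + t ≤ c n := by
    intro t
    induction t with
    | zero => exact ⟨0, by simp⟩
    | succ t ih =>
      obtain ⟨n, hn⟩ := ih
      obtain ⟨n', h1, h2⟩ := (h n).1
      have := List.length_pos_of_ne_nil h2
      have := hmono h1
      exact ⟨n' + 1, by rw [hstep]; push_cast; omega⟩
  have hdown : ∀ t : ℕ, ∃ n, c n ≤ c 0 - t := by
    intro t
    induction t with
    | zero => exact ⟨0, by simp⟩
    | succ t ih =>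
      obtain ⟨n, hn⟩ := ih
      obtain ⟨n', h1, h2⟩ := (h (n - 1)).2
      have := List.length_pos_of_ne_nil h2
      have h3 := hmono (show n' + 1 ≤ n by omega)
      rw [hstep] at h3
      exact ⟨n', by push_cast; omega⟩
  obtain ⟨n, hn⟩ := hup (M - c 0).toNat
  obtain ⟨n', hn'⟩ := hdown (c 0 - M).toNat
  exact ⟨⟨n, by omega⟩, ⟨n', by omega⟩⟩

theorem IsParse.inDomain {c : ℤ → ℤ} (h : IsParse (letterImage σ) y x c) : InDomain σ x := by
  intro N
  constructor
  · by_contra hno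
    push Not at hno
    have hc : ∀ k : ℕ, c (N + k) = c N := by
      intro k
      induction k with
      | zero => simp
      | succ k ih =>
        push_cast
        rw [← add_assoc, h.step, ih, hno (N + k) (by omega)]
        simp
    obtain ⟨n, hn⟩ := h.above (c N + 1)
    have : N < n := by
      by_contra hle
      have := h.monotone (not_lt.1 hle)
      omega
    obtain ⟨k, rfl⟩ := Int.le.dest this.le
    have := hc k
    omega
  · by_contra hno
    push Not at hno
    have hc : ∀ k : ℕ, c (N + 1 - k) = c (N + 1) := by
      intro k
      induction k with
      | zero => simp
      | succ k ih =>
        rw [← ih]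
        have := h.step (N + 1 - (k + 1 : ℕ))
        rw [hno _ (by push_cast; omega),
          show N + 1 - ((k + 1 : ℕ) : ℤ) + 1 = N + 1 - k by push_cast; ring] at this
        simp at this ⊢
        exact this.symm
    obtain ⟨n, hn⟩ := h.below (c (N + 1) - 1)
    have : n < N + 1 := by
      by_contra hle
      have := h.monotone (not_lt.1 hle)
      omega
    have := hc (N + 1 - n).toNat
    rw [show N + 1 - ((N + 1 - n).toNat : ℤ) = n by omega] at this
    omega

theorem IsRepresentation.exists_isParse {k : ℤ} (h : IsRepresentation σ y x k) :
    ∃ c, IsParse (letterImage σ) y x c ∧ c 0 = -k := by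
  obtain ⟨z, ⟨hdom, hz⟩, rfl⟩ := h
  have hstep : ∀ n, blockStart σ x (n + 1) - k =
      blockStart σ x n - k + (letterImage σ (x n)).length := fun n => by
    rw [blockStart_succ]; ring
  have hunb := hdom.exists_le (c := fun n => blockStart σ x n - k) hstep
  refine ⟨fun n => blockStart σ x n - k, ⟨hstep, fun n => ?_, fun M => (hunb M).1,
    fun M => (hunb M).2⟩, by simp [blockStart]⟩
  rw [OccursAt, pointFactor_shiftPow, sub_add_cancel]
  exact hz n

theorem IsParse.isRepresentation {c : ℤ → ℤ} (h : IsParse (letterImage σ) y x c) :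
    IsRepresentation σ y x (-c 0) := by
  refine ⟨shiftPow (c 0) y, ⟨h.inDomain, fun n => ?_⟩, funext fun n => by simp [shiftPow]⟩
  have hc : blockStart σ x n + c 0 = c n := by
    have := eq_of_forall_succ_eq (g := fun n => c n - blockStart σ x n) (fun n => by
      rw [blockStart_succ, h.step]
      ring) n 0
    simp only [show blockStart σ x 0 = 0 by simp [blockStart]] at this
    omega
  rw [pointFactor_shiftPow, hc]
  exact h.occursAt n

end Representations

/-! ### Generators of the S-adic language and descent of levels -/

section SadicLanguage

theorem toList_map_eq_flatMap {A B : Type*} (σ : FreeMonoid A →* FreeMonoid B)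
    (w : FreeMonoid A) :
    FreeMonoid.toList (σ w) = (FreeMonoid.toList w).flatMap (letterImage σ) := by
  induction w using FreeMonoid.inductionOn' with
  | one => simp
  | of_mul a w ih => simp [letterImage, ih]

variable {A : ℕ → Type*} (σ : ∀ n, FreeMonoid (A (n + 1)) →* FreeMonoid (A n))

theorem map_cast {i j : ℕ} (h : i = j) (w : FreeMonoid (A (i + 1))) :
    σ j (cast (congrArg (fun i => FreeMonoid (A (i + 1))) h) w) =
      cast (congrArg (fun i => FreeMonoid (A i)) h) (σ i w) := by
  subst h; rfl

/-- `sadicComp` grows at its innermost end, while descending a level needs the outermost morphism `σ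
n` split off; the cast reconciles the two index expressions. -/
theorem sadicComp_succ_cast (n j : ℕ) (h : n + 1 + j = n + (j + 1))
    (w : FreeMonoid (A (n + 1 + j))) :
    sadicComp σ n (j + 1) (cast (congrArg (fun i => FreeMonoid (A i)) h) w) =
      σ n (sadicComp σ (n + 1) j w) := by
  induction j with
  | zero => rfl
  | succ j ih =>
    have h' : n + 1 + j = n + (j + 1) := by omega
    have := ih h' (σ (n + 1 + j) w)
    rw [← map_cast σ h'] at this
    exact this

theorem of_cast {i j : ℕ} (h : i = j) (a : A i) :
    FreeMonoid.of (cast (congrArg A h) a) =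
      cast (congrArg (fun i => FreeMonoid (A i)) h) (FreeMonoid.of a) := by
  subst h; rfl

theorem letterImage_sadicComp_succ (n j : ℕ) (h : n + 1 + j = n + (j + 1)) (a : A (n + 1 + j)) :
    letterImage (sadicComp σ n (j + 1)) (cast (congrArg A h) a) =
      (letterImage (sadicComp σ (n + 1) j) a).flatMap (letterImage (σ n)) := by
  rw [letterImage, of_cast h, sadicComp_succ_cast σ n j h, toList_map_eq_flatMap]
  rfl

variable {σ}

theorem flatMap_infix {A B : Type*} (f : A → List B) {v w : List A} (h : v <:+: w) :
    v.flatMap f <:+: w.flatMap f := by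
  obtain ⟨s, t, rfl⟩ := h
  rw [List.flatMap_append, List.flatMap_append]
  exact ⟨_, _, rfl⟩

theorem mem_sadicLanguage_of_infix {n : ℕ} {v w : List (A n)} (h : v <:+: w)
    (hw : w ∈ sadicLanguage σ n) : v ∈ sadicLanguage σ n := by
  obtain ⟨j, a, hw⟩ := hw
  exact ⟨j, a, h.trans hw⟩

theorem flatMap_mem_sadicLanguage {n : ℕ} {w : List (A (n + 1))}
    (hw : w ∈ sadicLanguage σ (n + 1)) :
    w.flatMap (letterImage (σ n)) ∈ sadicLanguage σ n := by
  obtain ⟨j, a, hw⟩ := hw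
  refine ⟨j + 1, cast (congrArg A (by omega)) a, ?_⟩
  rw [letterImage_sadicComp_succ σ n j (by omega)]
  exact flatMap_infix _ hw

/-- The letters of level `n` itself need not occur in images from level `n + 1`; this is why
`Generates` tolerates words of bounded length. -/
theorem length_le_one_or_infix_of_mem_sadicLanguage {n : ℕ} {w : List (A n)}
    (hw : w ∈ sadicLanguage σ n) :
    w.length ≤ 1 ∨ ∃ v ∈ sadicLanguage σ (n + 1), w <:+: v.flatMap (letterImage (σ n)) := by
  obtain ⟨j | j, a, hw⟩ := hw
  · exact .inl hw.length_le
  · have h : n + 1 + j = n + (j + 1) := by omega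
    obtain ⟨a, rfl⟩ : ∃ a', a = cast (congrArg A h) a' :=
      ⟨cast (congrArg A h.symm) a, by simp⟩
    rw [letterImage_sadicComp_succ σ n j h] at hw
    exact .inr ⟨_, ⟨j, a, List.infix_rfl⟩, hw⟩

theorem not_mem_wordShift_of_eq_nil {C B : Type*} {f : C → List B} (hf : ∀ a, f a = [])
    {L : Set (List C)} {y : ℤ → B} : y ∉ wordShift f L := by
  intro hy
  obtain ⟨w, -, hw⟩ := hy 0 1
  rw [List.flatMap_eq_nil_iff.2 fun a _ => hf a] at hw
  simp [pointFactor_succ] at hw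

/-- Up to words of bounded length, the language at level `n` consists of the factors of the
images under `f` of words of `L`. -/
structure Generates (σ : ∀ n, FreeMonoid (A (n + 1)) →* FreeMonoid (A n)) (n : ℕ) {C : Type*}
    (f : C → List (A n)) (L : Set (List C)) : Prop where
  infix_of_mem : ∃ b, ∀ w ∈ sadicLanguage σ n, w.length ≤ b ∨ ∃ v ∈ L, w <:+: v.flatMap f
  flatMap_mem : ∀ v ∈ L, v.flatMap f ∈ sadicLanguage σ n

namespace Generates

variable {n : ℕ} {C : Type*} {f : C → List (A n)} {L : Set (List C)}

theorem sadicShift_eq (h : Generates σ n f L) : sadicShift σ n = wordShift f L := by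
  obtain ⟨b, hb⟩ := h.infix_of_mem
  ext y
  refine ⟨fun hy i l => ?_, fun hy i l => ?_⟩
  -- Factors of a point extend beyond length `b`, so the exceptional words do not matter.
  · obtain hlen | ⟨v, hv, hi⟩ := hb _ (hy i (l + (b + 1)))
    · rw [length_pointFactor] at hlen; omega
    · exact ⟨v, hv, (pointFactor_prefix y i (by omega)).isInfix.trans hi⟩
  · obtain ⟨v, hv, hi⟩ := hy i l
    exact mem_sadicLanguage_of_infix hi (h.flatMap_mem v hv)

theorem factor {D : Type*} (h : Generates σ n f L) {β : C → List D} {α : D → List (A n)}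
    (hf : ∀ a, f a = (β a).flatMap α) : Generates σ n α ((fun v => v.flatMap β) '' L) := by
  have key : ∀ v : List C, (v.flatMap β).flatMap α = v.flatMap f := fun v => by
    rw [List.flatMap_assoc, funext hf]
  obtain ⟨b, hb⟩ := h.infix_of_mem
  refine ⟨⟨b, fun w hw => (hb w hw).imp_right ?_⟩, ?_⟩
  · rintro ⟨v, hv, hi⟩
    exact ⟨_, ⟨v, hv, rfl⟩, by rwa [key]⟩
  · rintro _ ⟨v, hv, rfl⟩
    dsimp only
    rw [key]
    exact h.flatMap_mem v hv

theorem pred [∀ n, Finite (A n)] {f : C → List (A (n + 1))} (h : Generates σ (n + 1) f L) :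
    Generates σ n (fun a => (f a).flatMap (letterImage (σ n))) L := by
  have := Fintype.ofFinite (A (n + 1))
  obtain ⟨b, hb⟩ := h.infix_of_mem
  let R := ∑ a, (letterImage (σ n) a).length
  have hR : ∀ w : List (A (n + 1)), (w.flatMap (letterImage (σ n))).length ≤ w.length * R := by
    intro w
    induction w with
    | nil => simp
    | cons a w ih =>
      have := Finset.single_le_sum (f := fun a => (letterImage (σ n) a).length)
        (fun _ _ => Nat.zero_le _) (Finset.mem_univ a)
      rw [List.flatMap_cons, List.length_append, List.length_cons, Nat.succ_mul]
      change _ ≤ R at this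
      omega
  -- New exceptions are single letters, or factors of images of old exceptions, each letter of which
  -- has an image of length at most `R`.
  refine ⟨⟨max 1 (b * R), fun w hw => ?_⟩, fun v hv => ?_⟩
  · obtain hw | ⟨v, hv, hi⟩ := length_le_one_or_infix_of_mem_sadicLanguage hw
    · exact .inl (hw.trans (le_max_left _ _))
    · obtain hlen | ⟨u, hu, hvu⟩ := hb v hv
      · exact .inl ((hi.length_le.trans ((hR v).trans (Nat.mul_le_mul_right _ hlen))).trans
          (le_max_right _ _))
      · refine .inr ⟨u, hu, hi.trans ?_⟩
        rw [← List.flatMap_assoc]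
        exact flatMap_infix _ hvu
  · rw [← List.flatMap_assoc]
    exact flatMap_mem_sadicLanguage (h.flatMap_mem v hv)

theorem exists_of_le [∀ n, Finite (A n)] {m : ℕ} {f : C → List (A m)} (h : Generates σ m f L)
    (hnm : n ≤ m) : ∃ f' : C → List (A n), Generates σ n f' L := by
  induction hnm using Nat.decreasingInduction with
  | self => exact ⟨f, h⟩
  | of_succ k hk ih =>
    obtain ⟨f', hf'⟩ := ih
    exact ⟨_, hf'.pred⟩

theorem recognizableForAperiodicAt [∀ n, Finite (A n)] [Fintype C] {f : C → List (A (n + 1))}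
    (h : Generates σ (n + 1) f L)
    (hel : ¬ FactorsThrough (fun a => (f a).flatMap (letterImage (σ n))) (Fintype.card C - 1)) :
    RecognizableForAperiodicAt σ n := by
  rintro y hy x hx x' hx' k k' ⟨hr, hk, hk1⟩ ⟨hr', hk', hk1'⟩
  rw [h.sadicShift_eq] at hx hx'
  obtain ⟨b, hb, hb0⟩ := hr.exists_isParse
  obtain ⟨b', hb', hb0'⟩ := hr'.exists_isParse
  have hb1 := hb.step 0
  have hb1' := hb'.step 0
  rw [zero_add] at hb1 hb1'
  obtain ⟨hxx, hbb⟩ := eq_of_isParse_of_not_factorsThrough hel hy hx hx' hb hb'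
    ⟨by omega, by omega⟩ ⟨by omega, by omega⟩
  exact ⟨hxx, by omega⟩

theorem representableAt [∀ n, Finite (A n)] [Fintype C] {f : C → List (A (n + 1))}
    (h : Generates σ (n + 1) f L)
    (hel : ¬ FactorsThrough (fun a => (f a).flatMap (letterImage (σ n))) (Fintype.card C - 1)) :
    RepresentableAt σ n := by
  intro y hy
  rw [h.pred.sadicShift_eq] at hy
  obtain ⟨x, hx, b, hb⟩ := exists_isParse_of_not_factorsThrough hel hy
  exact ⟨x, h.sadicShift_eq ▸ hx, _, hb.isRepresentation⟩

theorem recognizableForAperiodicAt_of_eq_nil {f : C → List (A (n + 1))}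
    (h : Generates σ (n + 1) f L) (hnil : ∀ a, (f a).flatMap (letterImage (σ n)) = []) :
    RecognizableForAperiodicAt σ n := by
  rintro y - x hx - - k - ⟨⟨z, ⟨hdom, -⟩, -⟩, -⟩ -
  exfalso
  rw [h.sadicShift_eq] at hx
  obtain ⟨i, -, hi⟩ := (hdom 0).1
  obtain ⟨w, -, hw⟩ := hx i 1
  have := flatMap_infix (letterImage (σ n)) hw
  rw [List.flatMap_assoc, List.flatMap_eq_nil_iff.2 fun a _ => hnil a] at this
  exact hi (by simpa [pointFactor_succ] using this)

theorem representableAt_of_eq_nil [∀ n, Finite (A n)] {f : C → List (A (n + 1))}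
    (h : Generates σ (n + 1) f L) (hnil : ∀ a, (f a).flatMap (letterImage (σ n)) = []) :
    RepresentableAt σ n := by
  intro y hy
  exfalso
  rw [h.pred.sadicShift_eq] at hy
  exact not_mem_wordShift_of_eq_nil hnil hy

/-- A level that is not recognizable or not representable lowers the number of generators. -/
theorem exists_generates_pred [∀ n, Finite (A n)] {k : ℕ} {f : Fin k → List (A (n + 1))}
    {L : Set (List (Fin k))} (h : Generates σ (n + 1) f L)
    (hbad : ¬ RecognizableForAperiodicAt σ n ∨ ¬ RepresentableAt σ n) :
    2 ≤ k ∧ ∃ (f' : Fin (k - 1) → List (A n)) (L' : Set (List (Fin (k - 1)))),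
      Generates σ n f' L' := by
  by_cases hel : FactorsThrough (fun a => (f a).flatMap (letterImage (σ n))) (k - 1)
  · obtain ⟨β, α, hf⟩ := hel
    refine ⟨?_, α, _, h.pred.factor hf⟩
    -- For `k ≤ 1` the truncated `k - 1` is 0: the composite erases everything and the level is
    -- vacuously good.
    by_contra hk
    have : IsEmpty (Fin (k - 1)) := ⟨fun i => by have := i.isLt; omega⟩
    have hnil : ∀ a, (f a).flatMap (letterImage (σ n)) = [] := fun a => by
      exact (hf a).trans (List.flatMap_eq_nil_iff.2 fun b _ => isEmptyElim b)
    exact hbad.elim (· (h.recognizableForAperiodicAt_of_eq_nil hnil))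
      (· (h.representableAt_of_eq_nil hnil))
  · exact (hbad.elim (· (h.recognizableForAperiodicAt (by simpa using hel)))
      (· (h.representableAt (by simpa using hel)))).elim

end Generates

theorem isPeriodicPoint_of_mem_wordShift {C B : Type*} [Finite C] [Subsingleton C]
    {f : C → List B} {L : Set (List C)} {y : ℤ → B} (hy : y ∈ wordShift f L) :
    IsPeriodicPoint y := by
  have hf : ∀ a, f a ≠ [] := by
    intro a ha
    exact not_mem_wordShift_of_eq_nil (fun b => by rw [Subsingleton.elim b a, ha]) hy
  obtain ⟨x, c, hx, -⟩ := exists_isParse_of_mem_wordShift hf hy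
  refine ⟨(f (x 0)).length, List.length_pos_of_ne_nil (hf _), funext fun m => ?_⟩
  obtain ⟨n, h1, h2⟩ := hx.exists_index m
  rw [hx.step] at h2
  obtain ⟨k, rfl⟩ := Int.le.dest h1
  have hk : k < (f (x n)).length := by omega
  have hx1 : x (n + 1) = x n := Subsingleton.elim _ _
  have ho := hx.occursAt (n + 1)
  rw [hx1] at ho
  rw [shiftPow, Subsingleton.elim (x 0) (x n), add_right_comm, ← hx.step, ho.getElem hk,
    (hx.occursAt n).getElem hk]

theorem generates_of_equiv {n : ℕ} {C : Type*} (e : C ≃ A n) :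
    Generates σ n (fun a => [e a]) {v | v.map e ∈ sadicLanguage σ n} := by
  have key : ∀ v : List C, v.flatMap (fun a => [e a]) = v.map e := fun v =>
    (List.map_eq_flatMap ..).symm
  refine ⟨⟨0, fun w hw => .inr ⟨w.map e.symm, ?_, ?_⟩⟩, fun v hv => ?_⟩
  · simpa using hw
  · rw [key]; simp
  · rw [key]; exact hv

end SadicLanguage

/-! ### Counting the bad levels -/

theorem mainTheorem2 {A : ℕ → Type*} [∀ n, Finite (A n)]
    (σ : ∀ n, FreeMonoid (A (n + 1)) →* FreeMonoid (A n))
    (m K : ℕ) (hA : Nonempty (A m)) (n : ℕ → ℕ)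
    (hanti : StrictAntiOn n (Set.Icc 1 K))
    (hlt : ∀ k ∈ Set.Icc 1 K, n k < m)
    (hbad : ∀ k ∈ Set.Icc 1 K,
      ¬ RecognizableForAperiodicAt σ (n k) ∨ ¬ RepresentableAt σ (n k)) :
    K < Nat.card (A m) ∧
      (K + 1 = Nat.card (A m) → 1 ≤ K →
        ∀ x ∈ sadicShift σ (n K), IsPeriodicPoint x) := by
  -- The level reached after `i` bad levels, with `Nat.card (A m) - i` generators left; descending
  -- from `ν i` to `n (i + 1) + 1` keeps their number.
  let ν : ℕ → ℕ := fun i => if i = 0 then m else n i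
  have hν : ∀ i, i + 1 ≤ K → n (i + 1) + 1 ≤ ν i := by
    intro i hi
    rcases Nat.eq_zero_or_pos i with rfl | hpos
    · exact hlt 1 ⟨le_rfl, hi⟩
    · simpa [ν, hpos.ne'] using hanti ⟨hpos, by omega⟩ ⟨by omega, hi⟩ (Nat.lt_succ_self i)
  have key : ∀ i ≤ K, i < Nat.card (A m) ∧ ∃ (f : Fin (Nat.card (A m) - i) → List (A (ν i)))
      (L : Set (List (Fin (Nat.card (A m) - i)))), Generates σ (ν i) f L := by
    intro i
    induction i with
    | zero =>
      exact fun _ => ⟨Nat.card_pos, _, _, generates_of_equiv (Finite.equivFin (A m)).symm⟩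
    | succ i ih =>
      intro hi
      obtain ⟨hcard, f, L, hL⟩ := ih (by omega)
      obtain ⟨f', hf'⟩ := hL.exists_of_le (hν i hi)
      obtain ⟨h2, hgen⟩ := hf'.exists_generates_pred (hbad (i + 1) ⟨by omega, hi⟩)
      rw [Nat.sub_sub] at hgen
      exact ⟨by omega, hgen⟩
  obtain ⟨hcard, f, L, hL⟩ := key K le_rfl
  refine ⟨hcard, fun hK hK1 x hx => ?_⟩
  have hsub : Subsingleton (Fin (Nat.card (A m) - K)) := by
    rw [← hK, Nat.add_sub_cancel_left]
    infer_instance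
  obtain ⟨k, rfl⟩ := Nat.exists_eq_add_of_le' hK1
  have hL' : Generates σ (n (k + 1)) f L := hL
  rw [hL'.sadicShift_eq] at hx
  exact isPeriodicPoint_of_mem_wordShift hx
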